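/- Let $A$ be a complex $n\times n$ matrix, $B$ a complex $m\times m$ matrix ($n$ and $m$ may differ), $c\in\mathbb{R}^n$ and $d\in\mathbb{R}^m$. The $c$-numerical range of $A$ is $$W_c(A)=\Big\{\sum_{j=1}^n c_j\,x_j^*Ax_j \ :\ x_1,\dots,x_n\in\mathbb{C}^n \text{ orthonormal}\Big\},$$ and $W_d(B)$ is defined in the same way. Let $\lambda_1(A),\dots,\lambda_n(A)$ be the eigenvalues of $A$, repeated according to algebraic multiplicity, and let $c_{i_1},\dots,c_{i_r}$ be the nonzero entries of $c$. A $c$-value of $A$ is a number of the form $c_{i_1}\lambda_{j_1}(A)+\cdots+c_{i_r}\lambda_{j_r}(A)$ with pairwise distinct indices $j_1,\dots,j_r\in\{1,\dots,n\}$ (if $c=0$, the only $c$-value is $0$); the $d$-values of $B$ are defined in the same way. If $W_c(A)=W_d(B)$, then there exists a $c$-value of $A$ which is also a $d$-value of $B$. -/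

import Mathlib

/-- The `c`-numerical range of `A`: all numbers `∑ j, c j * (x j)ᴴ A (x j)`, where
`x 1, …, x n` runs over the orthonormal families in `ℂⁿ`. -/
def cNumericalRange {n : ℕ} (c : Fin n → ℝ) (A : Matrix (Fin n) (Fin n) ℂ) : Set ℂ :=
  {z | ∃ x : Fin n → EuclideanSpace ℂ (Fin n), Orthonormal ℂ x ∧
    z = ∑ j, (c j : ℂ) * (star (x j).ofLp ⬝ᵥ (A.mulVec (x j).ofLp))}

/-- `lam` lists the `n` eigenvalues of `A`, repeated according to algebraic multiplicity. -/
def IsEigenvalueList {n : ℕ} (A : Matrix (Fin n) (Fin n) ℂ) (lam : Fin n → ℂ) : Prop :=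
  A.charpoly.roots = (Finset.univ : Finset (Fin n)).val.map lam

/-- `z` is a `c`-value of `A`: it is the sum of `c i * lam (j i)` over the indices `i` with
`c i ≠ 0`, where `lam` lists the eigenvalues of `A` and the indices `j i` are distinct. -/
def IsCValue {n : ℕ} (c : Fin n → ℝ) (A : Matrix (Fin n) (Fin n) ℂ) (z : ℂ) : Prop :=
  ∃ lam : Fin n → ℂ, IsEigenvalueList A lam ∧
    ∃ j : {i : Fin n // c i ≠ 0} ↪ Fin n, z = ∑ i, (c i.1 : ℂ) * lam (j i)

open Matrix Polynomial

/-! For real `s`, the maximum of `Re z + s Im z` over `W_c(A)` is a `c`-sum of eigenvalues of the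
Hermitian matrix `Re A + s Im A`, by Birkhoff's theorem. If the ranges agree, so do these maxima,
and the product of all differences of `d`-sums and `c`-sums vanishes at every real `s`. The product
is symmetric in each list of eigenvalues, hence a polynomial in `s` (`exists_polynomial_prod_sub`),
hence identically zero. At `s = i` the pencils are `A` and `B` themselves, and some factor must
vanish there. -/

/-- The matrix pencil `Re A + X • Im A`, where `Re A = (A + Aᴴ) / 2` and
`Im A = (A - Aᴴ) / 2i`. -/
noncomputable def hermitianPencil {n : ℕ} (A : Matrix (Fin n) (Fin n) ℂ) :
    Matrix (Fin n) (Fin n) ℂ[X] :=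
  Matrix.of fun i j => C ((A i j + star (A j i)) / 2) +
    X * C (-Complex.I / 2 * (A i j - star (A j i)))

theorem hermitianPencil_map_eval {n : ℕ} (A : Matrix (Fin n) (Fin n) ℂ) (s : ℂ) :
    (hermitianPencil A).map (evalRingHom s) =
      (1 / 2 : ℂ) • (A + Aᴴ) + (s * (-Complex.I / 2)) • (A - Aᴴ) := by
  ext i j
  simp [hermitianPencil]
  ring

theorem hermitianPencil_map_eval_I {n : ℕ} (A : Matrix (Fin n) (Fin n) ℂ) :
    (hermitianPencil A).map (evalRingHom Complex.I) = A := by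
  rw [hermitianPencil_map_eval]
  ext i j
  simp only [Matrix.add_apply, Matrix.smul_apply, Matrix.sub_apply, smul_eq_mul]
  linear_combination (-1 / 2 * (A i j - Aᴴ i j)) * Complex.I_mul_I

theorem isHermitian_hermitianPencil_map_eval {n : ℕ} (A : Matrix (Fin n) (Fin n) ℂ) (s : ℝ) :
    ((hermitianPencil A).map (evalRingHom (s : ℂ))).IsHermitian := by
  ext i j
  simp [hermitianPencil]
  ring

theorem hermitianPencil_quadForm {n : ℕ} (A : Matrix (Fin n) (Fin n) ℂ) (s : ℝ)
    (v : Fin n → ℂ) :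
    (star v ⬝ᵥ ((hermitianPencil A).map (evalRingHom (s : ℂ))) *ᵥ v).re =
      (star v ⬝ᵥ A *ᵥ v).re + s * (star v ⬝ᵥ A *ᵥ v).im := by
  have h : star v ⬝ᵥ Aᴴ *ᵥ v = star (star v ⬝ᵥ A *ᵥ v) := by
    rw [Matrix.star_dotProduct, star_mulVec, ← dotProduct_mulVec, conjTranspose_conjTranspose]
  rw [hermitianPencil_map_eval, add_mulVec, smul_mulVec, smul_mulVec, add_mulVec, sub_mulVec,
    dotProduct_add, dotProduct_smul, dotProduct_smul, dotProduct_add, dotProduct_sub, h]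
  simp
  ring

/-- A symmetric polynomial in the eigenvalues of `M.map φ` is the image under `φ` of an element
independent of `φ`. -/
theorem MvPolynomial.IsSymmetric.exists_eval₂_eigenvalues {R S : Type*} [CommRing R] [CommRing S]
    [IsDomain S] {n : ℕ} (M : Matrix (Fin n) (Fin n) R) {F : MvPolynomial (Fin n) R}
    (hF : F.IsSymmetric) :
    ∃ r : R, ∀ (φ : R →+* S) (lam : Fin n → S),
      (M.map φ).charpoly.roots = (Finset.univ : Finset (Fin n)).val.map lam →
        MvPolynomial.eval₂ φ lam F = φ r := by
  obtain ⟨q, hq⟩ := MvPolynomial.esymmAlgHom_surjective (σ := Fin n) R (n := n) (by simp) ⟨F, hF⟩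
  have hq' : F = MvPolynomial.aeval
      (fun i : Fin n => MvPolynomial.esymm (Fin n) R (i + 1)) q := by
    rw [← MvPolynomial.esymmAlgHom_apply, hq]
  -- Vieta: the index `i : Fin n` stands for the elementary symmetric polynomial of degree `i + 1`.
  refine ⟨MvPolynomial.eval (fun i : Fin n => (-1) ^ (i + 1 : ℕ) * M.charpoly.coeff (n - (i + 1))) q,
    fun φ lam h => ?_⟩
  have hmonic := (M.map φ).charpoly_monic
  have hdeg : (M.map φ).charpoly.natDegree = n := by simp [charpoly_natDegree_eq_dim]
  have hcard : Multiset.card (M.map φ).charpoly.roots = (M.map φ).charpoly.natDegree := by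
    rw [hdeg, h]; simp
  have key (i : Fin n) : MvPolynomial.eval₂ φ lam (MvPolynomial.esymm (Fin n) R (i + 1)) =
      φ ((-1) ^ (i + 1 : ℕ) * M.charpoly.coeff (n - (i + 1))) := by
    have h1 := coeff_eq_esymm_roots_of_card hcard (k := n - (i + 1)) (by omega)
    rw [hdeg, h, hmonic.leadingCoeff, charpoly_map, Polynomial.coeff_map,
      show n - (n - ((i : ℕ) + 1)) = i + 1 by omega] at h1
    rw [map_mul, h1, map_pow, map_neg, map_one, one_mul, ← mul_assoc, ← mul_pow, neg_one_mul,
      neg_neg, one_pow, one_mul]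
    let := φ.toAlgebra
    exact MvPolynomial.aeval_esymm_eq_multiset_esymm (Fin n) R (i + 1) lam
  rw [hq', MvPolynomial.eval, MvPolynomial.coe_eval₂Hom, MvPolynomial.aeval_def,
    ← MvPolynomial.coe_eval₂Hom φ lam,
    ← MvPolynomial.coe_eval₂Hom (RingHom.id R), MvPolynomial.hom_eval₂]
  simp only [MvPolynomial.coe_eval₂Hom]
  rw [MvPolynomial.hom_eval₂]
  congr 1
  · ext r; simp
  · ext i; exact key i

/-- A product over all permutations of a polynomial's renamings is symmetric. -/
theorem MvPolynomial.isSymmetric_prod_rename {R : Type*} [CommRing R] {n : ℕ}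
    (G : MvPolynomial (Fin n) R) :
    (∏ σ : Equiv.Perm (Fin n), MvPolynomial.rename σ G).IsSymmetric := by
  intro e
  rw [map_prod]
  refine Fintype.prod_equiv (Equiv.mulLeft e) _ _ fun σ => ?_
  rw [MvPolynomial.rename_rename]
  rfl

/-- The product of all differences of `c`-sums of eigenvalues of `φ(M)` and `d`-sums of
eigenvalues of `φ(N)` depends polynomially on the parameter. -/
theorem exists_polynomial_prod_sub {n m : ℕ} (M : Matrix (Fin n) (Fin n) ℂ[X])
    (N : Matrix (Fin m) (Fin m) ℂ[X]) (c : Fin n → ℂ) (d : Fin m → ℂ) :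
    ∃ p : ℂ[X], ∀ (s : ℂ) (lam : Fin n → ℂ) (mu : Fin m → ℂ),
      IsEigenvalueList (M.map (evalRingHom s)) lam →
      IsEigenvalueList (N.map (evalRingHom s)) mu →
      p.eval s = ∏ τ : Equiv.Perm (Fin m), ∏ σ : Equiv.Perm (Fin n),
        (∑ j, d j * mu (τ j) - ∑ j, c j * lam (σ j)) := by
  obtain ⟨r, hr⟩ := (MvPolynomial.isSymmetric_prod_rename
    (MvPolynomial.C (X : ℂ[X][X]) - ∑ j : Fin n, MvPolynomial.C (C (C (c j))) * MvPolynomial.X j)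
    ).exists_eval₂_eigenvalues (S := ℂ) (M.map C)
  obtain ⟨p, hp⟩ := (MvPolynomial.isSymmetric_prod_rename
    (eval₂ (MvPolynomial.C (σ := Fin m))
      (∑ j : Fin m, MvPolynomial.C (C (d j)) * MvPolynomial.X j) r)
    ).exists_eval₂_eigenvalues (S := ℂ) N
  refine ⟨p, fun s lam mu hlam hmu => ?_⟩
  rw [← coe_evalRingHom, ← hp (evalRingHom s) mu hmu, ← MvPolynomial.coe_eval₂Hom, map_prod]
  refine Finset.prod_congr rfl fun τ _ => ?_
  rw [MvPolynomial.coe_eval₂Hom, MvPolynomial.eval₂_rename, ← MvPolynomial.coe_eval₂Hom,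
    Polynomial.hom_eval₂]
  have hM : (M.map C).map (eval₂RingHom (evalRingHom s) (∑ j, d j * mu (τ j))) =
      M.map (evalRingHom s) := by
    ext i j; simp
  have h := hr (eval₂RingHom (evalRingHom s) (∑ j, d j * mu (τ j))) lam (by rw [hM]; exact hlam)
  rw [coe_eval₂RingHom] at h
  have hhom : (MvPolynomial.eval₂Hom (evalRingHom s) (mu ∘ τ)).comp MvPolynomial.C =
      evalRingHom s := by
    ext <;> simp
  have hsum : MvPolynomial.eval₂Hom (evalRingHom s) (mu ∘ τ)
      (∑ j : Fin m, MvPolynomial.C (C (d j)) * MvPolynomial.X j) = ∑ j, d j * mu (τ j) := by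
    simp
  rw [hhom, hsum, ← h, ← MvPolynomial.coe_eval₂Hom, map_prod]
  refine Finset.prod_congr rfl fun σ _ => ?_
  simp

/-- A bilinear form evaluated at a doubly stochastic matrix is bounded by its value at some
permutation. -/
theorem exists_perm_forall_doublyStochastic_le {n : ℕ} (c lam : Fin n → ℝ) :
    ∃ σ : Equiv.Perm (Fin n), ∀ S ∈ doublyStochastic ℝ (Fin n),
      ∑ j, c j * ∑ k, S j k * lam k ≤ ∑ j, c j * lam (σ j) := by
  obtain ⟨σ, hσ⟩ := Finite.exists_max fun σ : Equiv.Perm (Fin n) => ∑ j, c j * lam (σ j)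
  refine ⟨σ, fun S hS => ?_⟩
  -- Birkhoff: `S` is a convex combination of permutation matrices, and the form is linear in `S`.
  obtain ⟨w, hw0, hw1, rfl⟩ := exists_eq_sum_perm_of_mem_doublyStochastic hS
  calc _ = ∑ τ, w τ * ∑ j, c j * lam (τ j) := by
        simp only [Matrix.sum_apply, Matrix.smul_apply, smul_eq_mul, Finset.sum_mul,
          Finset.mul_sum]
        simp_rw [Finset.sum_comm (s := (Finset.univ : Finset (Fin n)))
          (t := (Finset.univ : Finset (Equiv.Perm (Fin n))))]
        refine Finset.sum_congr rfl fun τ _ => Finset.sum_congr rfl fun j _ => ?_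
        rw [Finset.sum_eq_single (τ j)]
        · simp [Equiv.Perm.permMatrix, PEquiv.toMatrix_apply]; ring
        · intro k _ hk
          simp [Equiv.Perm.permMatrix, PEquiv.toMatrix_apply, hk.symm]
        · simp
    _ ≤ ∑ τ, w τ * ∑ j, c j * lam (σ j) :=
        Finset.sum_le_sum fun τ _ => mul_le_mul_of_nonneg_left (hσ τ) (hw0 τ)
    _ = _ := by rw [← Finset.sum_mul, hw1, one_mul]

theorem Matrix.IsHermitian.quadForm_eq_sum {n : ℕ} {H : Matrix (Fin n) (Fin n) ℂ}
    (hH : H.IsHermitian) (x : EuclideanSpace ℂ (Fin n)) :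
    (star x.ofLp ⬝ᵥ H *ᵥ x.ofLp).re =
      ∑ k, ‖inner ℂ x (hH.eigenvectorBasis k)‖ ^ 2 * hH.eigenvalues k := by
  have h1 : star x.ofLp ⬝ᵥ H *ᵥ x.ofLp = inner ℂ x (WithLp.toLp 2 (H *ᵥ x.ofLp)) := by
    rw [EuclideanSpace.inner_eq_star_dotProduct, dotProduct_comm]
  have h2 (k : Fin n) : inner ℂ (hH.eigenvectorBasis k) (WithLp.toLp 2 (H *ᵥ x.ofLp)) =
      (hH.eigenvalues k : ℂ) * inner ℂ (hH.eigenvectorBasis k) x := by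
    rw [EuclideanSpace.inner_eq_star_dotProduct, EuclideanSpace.inner_eq_star_dotProduct,
      dotProduct_comm, dotProduct_mulVec]
    have := congrArg star (hH.mulVec_eigenvectorBasis k)
    rw [star_mulVec, hH.eq] at this
    rw [this, dotProduct_comm x.ofLp]
    simp
  rw [h1, ← hH.eigenvectorBasis.sum_inner_mul_inner, Complex.re_sum]
  refine Finset.sum_congr rfl fun k _ => ?_
  rw [h2, mul_left_comm, ← inner_conj_symm (hH.eigenvectorBasis k) x, Complex.mul_conj,
    Complex.normSq_eq_norm_sq, ← Complex.ofReal_mul, Complex.ofReal_re, mul_comm]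

/-- Parseval in `b` gives the row sums. By dimension `x` is also a basis, and Parseval in `x` gives
the column sums. -/
theorem Orthonormal.mem_doublyStochastic {n : ℕ} {x : Fin n → EuclideanSpace ℂ (Fin n)}
    (hx : Orthonormal ℂ x) (b : OrthonormalBasis (Fin n) ℂ (EuclideanSpace ℂ (Fin n))) :
    (Matrix.of fun j k => ‖inner ℂ (x j) (b k)‖ ^ 2) ∈ doublyStochastic ℝ (Fin n) := by
  have hspan : ⊤ ≤ Submodule.span ℂ (Set.range x) :=
    (hx.linearIndependent.span_eq_top_of_card_eq_finrank' (by simp)).ge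
  rw [mem_doublyStochastic_iff_sum]
  refine ⟨fun i j => by simp, fun j => ?_, fun k => ?_⟩
  · simp [b.sum_sq_norm_inner_left, hx.1 j]
  · have := (OrthonormalBasis.mk hx hspan).sum_sq_norm_inner_right (b k)
    simpa using this

/-- The maximum of `∑ j, c j * (x j)ᴴ H (x j)` over orthonormal families is a `c`-sum of
eigenvalues of the Hermitian matrix `H`. -/
theorem Matrix.IsHermitian.exists_isGreatest {n : ℕ} {H : Matrix (Fin n) (Fin n) ℂ}
    (hH : H.IsHermitian) (c : Fin n → ℝ) :
    ∃ σ : Equiv.Perm (Fin n), IsGreatest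
      {t : ℝ | ∃ x : Fin n → EuclideanSpace ℂ (Fin n), Orthonormal ℂ x ∧
        t = ∑ j, c j * (star (x j).ofLp ⬝ᵥ H *ᵥ (x j).ofLp).re}
      (∑ j, c j * hH.eigenvalues (σ j)) := by
  obtain ⟨σ, hσ⟩ := exists_perm_forall_doublyStochastic_le c hH.eigenvalues
  refine ⟨σ, ⟨fun j => hH.eigenvectorBasis (σ j),
    hH.eigenvectorBasis.orthonormal.comp σ σ.injective, ?_⟩, ?_⟩
  · refine Finset.sum_congr rfl fun j _ => ?_
    rw [hH.quadForm_eq_sum, Finset.sum_eq_single (σ j)]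
    · simp
    · intro k _ hk
      simp [hH.eigenvectorBasis.inner_eq_zero hk.symm]
    · simp
  · rintro _ ⟨x, hx, rfl⟩
    simp_rw [hH.quadForm_eq_sum]
    exact hσ _ (hx.mem_doublyStochastic hH.eigenvectorBasis)

theorem Matrix.IsHermitian.isEigenvalueList {n : ℕ} {H : Matrix (Fin n) (Fin n) ℂ}
    (hH : H.IsHermitian) : IsEigenvalueList H fun k => (hH.eigenvalues k : ℂ) :=
  hH.roots_charpoly_eq_eigenvalues

theorem exists_isEigenvalueList {n : ℕ} (A : Matrix (Fin n) (Fin n) ℂ) :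
    ∃ lam, IsEigenvalueList A lam := by
  have hcard : Multiset.card A.charpoly.roots = n := by
    rw [splits_iff_card_roots.mp (IsAlgClosed.splits _), charpoly_natDegree_eq_dim,
      Fintype.card_fin]
  obtain ⟨l, hl⟩ := Quot.exists_rep A.charpoly.roots
  change (l : Multiset ℂ) = _ at hl
  rw [← hl, Multiset.coe_card] at hcard
  subst hcard
  refine ⟨l.get, ?_⟩
  rw [IsEigenvalueList, ← hl, Fin.univ_val_map, List.ofFn_get]

/-- For real `s`, the support value of the `c`-numerical range in the direction `(1, s)` is a
`c`-sum of eigenvalues of the Hermitian matrix `Re A + s Im A`. -/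
theorem exists_isGreatest_image_cNumericalRange {n : ℕ} (A : Matrix (Fin n) (Fin n) ℂ)
    (c : Fin n → ℝ) (s : ℝ) :
    ∃ (lam : Fin n → ℝ) (σ : Equiv.Perm (Fin n)),
      IsEigenvalueList ((hermitianPencil A).map (evalRingHom (s : ℂ))) (fun k => (lam k : ℂ)) ∧
      IsGreatest ((fun z : ℂ => z.re + s * z.im) '' cNumericalRange c A)
        (∑ j, c j * lam (σ j)) := by
  have hH := isHermitian_hermitianPencil_map_eval A s
  obtain ⟨σ, hσ⟩ := hH.exists_isGreatest c
  refine ⟨hH.eigenvalues, σ, hH.isEigenvalueList, ?_⟩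
  convert hσ using 1
  have key (x : Fin n → EuclideanSpace ℂ (Fin n)) :
      (∑ j, (c j : ℂ) * (star (x j).ofLp ⬝ᵥ A *ᵥ (x j).ofLp)).re +
        s * (∑ j, (c j : ℂ) * (star (x j).ofLp ⬝ᵥ A *ᵥ (x j).ofLp)).im =
      ∑ j, c j * (star (x j).ofLp ⬝ᵥ
        ((hermitianPencil A).map (evalRingHom (s : ℂ))) *ᵥ (x j).ofLp).re := by
    simp_rw [hermitianPencil_quadForm, Complex.re_sum, Complex.im_sum, Complex.re_ofReal_mul,
      Complex.im_ofReal_mul, Finset.mul_sum, ← Finset.sum_add_distrib]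
    exact Finset.sum_congr rfl fun j _ => by ring
  ext t
  constructor
  · rintro ⟨_, ⟨x, hx, rfl⟩, rfl⟩
    exact ⟨x, hx, key x⟩
  · rintro ⟨x, hx, rfl⟩
    exact ⟨_, ⟨x, hx, rfl⟩, key x⟩

/-- Indices with `c j = 0` contribute nothing, so `σ` can be restricted to the support of `c`. -/
theorem IsEigenvalueList.isCValue {n : ℕ} {A : Matrix (Fin n) (Fin n) ℂ} {lam : Fin n → ℂ}
    (h : IsEigenvalueList A lam) (c : Fin n → ℝ) (σ : Equiv.Perm (Fin n)) :
    IsCValue c A (∑ j, (c j : ℂ) * lam (σ j)) := by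
  refine ⟨lam, h, (Function.Embedding.subtype _).trans σ.toEmbedding, ?_⟩
  rw [← Finset.sum_filter_of_ne (p := fun j => c j ≠ 0)]
  · exact Finset.sum_subtype (p := fun j => c j ≠ 0) _ (by simp)
      fun j => (c j : ℂ) * lam (σ j)
  · rintro j - hj hc
    simp [hc] at hj

theorem mainTheorem7 (n m : ℕ) (A : Matrix (Fin n) (Fin n) ℂ) (B : Matrix (Fin m) (Fin m) ℂ)
    (c : Fin n → ℝ) (d : Fin m → ℝ) (h : cNumericalRange c A = cNumericalRange d B) :
    ∃ z : ℂ, IsCValue c A z ∧ IsCValue d B z := by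
  obtain ⟨p, hp⟩ := exists_polynomial_prod_sub (hermitianPencil A) (hermitianPencil B)
    (fun j => (c j : ℂ)) (fun j => (d j : ℂ))
  have hzero : p = 0 := by
    refine eq_zero_of_infinite_isRoot p
      ((Set.infinite_range_of_injective Complex.ofReal_injective).mono ?_)
    rintro _ ⟨s, rfl⟩
    obtain ⟨lam, σ, hlam, hA⟩ := exists_isGreatest_image_cNumericalRange A c s
    obtain ⟨mu, τ, hmu, hB⟩ := exists_isGreatest_image_cNumericalRange B d s
    rw [h] at hA
    have heq := hA.unique hB
    change p.eval (s : ℂ) = 0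
    rw [hp s _ _ hlam hmu]
    -- The permutations attaining the two equal maxima select the vanishing factor.
    refine Finset.prod_eq_zero (Finset.mem_univ τ) (Finset.prod_eq_zero (Finset.mem_univ σ) ?_)
    rw [sub_eq_zero]
    exact_mod_cast heq.symm
  obtain ⟨lam, hlam⟩ := exists_isEigenvalueList A
  obtain ⟨mu, hmu⟩ := exists_isEigenvalueList B
  have hI := hp Complex.I lam mu (by rwa [hermitianPencil_map_eval_I])
    (by rwa [hermitianPencil_map_eval_I])
  rw [hzero, eval_zero, eq_comm, Finset.prod_eq_zero_iff] at hI
  obtain ⟨τ, -, hτ⟩ := hI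
  obtain ⟨σ, -, hσ⟩ := Finset.prod_eq_zero_iff.mp hτ
  refine ⟨_, hlam.isCValue c σ, ?_⟩
  rw [← sub_eq_zero.mp hσ]
  exact hmu.isCValue d τ
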